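/- Let $k$ and $q$ be positive integers. For every permutation $\pi$ of $[k-1]=\{1,\ldots,k-1\}$, every $q$-coloring of the edges of the complete graph on the vertex set $[R]=\{1,\ldots,R\}$ with $R=2^{k^{20q}}$ contains a monochromatic $K_k$ with vertices $a_1<\ldots<a_k$ satisfying $$a_{\pi(1)+1}-a_{\pi(1)}>a_{\pi(2)+1}-a_{\pi(2)}>\ldots>a_{\pi(k-1)+1}-a_{\pi(k-1)}.$$ That is, $R(k;q)\le 2^{k^{20q}}$, where $R(k;q)=\max_{\pi}R_{\pi}(k;q)$ over all permutations $\pi$ of $[k-1]$, and $R_{\pi}(k;q)$ is the least positive integer $R$ such that every $q$-coloring of the edges of the complete graph on $[R]$ contains a monochromatic $K_k$ with vertices $a_1<\ldots<a_k$ satisfying the displayed inequalities. -/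

import Mathlib

namespace OrderRamsey

/-- The `i`-th consecutive difference `a_{i+1} - a_i` of `a_1, …, a_k`, with indices starting
at `0`; there are `k - 1` of them. -/
def consecDiff {k : ℕ} (a : Fin k → ℕ) (i : Fin (k - 1)) : ℤ :=
  (a ⟨i.val + 1, by have := i.isLt; omega⟩ : ℤ) - (a ⟨i.val, by have := i.isLt; omega⟩ : ℤ)

/-- `a_{π(1)+1} - a_{π(1)} > a_{π(2)+1} - a_{π(2)} > … > a_{π(k-1)+1} - a_{π(k-1)}`. -/
def DiffsOrderedBy {k : ℕ} (π : Equiv.Perm (Fin (k - 1))) (a : Fin k → ℕ) : Prop :=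
  StrictAnti fun i : Fin (k - 1) => consecDiff a (π i)

/-- A `q`-coloring of the edges of the complete graph on the vertex set `[R] = {1, …, R}`. -/
abbrev Coloring (R q : ℕ) : Type :=
  SimpleGraph.TopEdgeLabeling (Set.Icc 1 R) (Fin q)

/-- The coloring `C` contains a monochromatic `K_k` with vertices `a_1 < … < a_k` whose
consecutive differences are ordered according to `π`. -/
def HasMonoClique {k q R : ℕ} (π : Equiv.Perm (Fin (k - 1))) (C : Coloring R q) : Prop :=
  ∃ a : Fin k → Set.Icc 1 R, StrictMono a ∧
    (∃ color : Fin q, (SimpleGraph.EdgeLabeling.labelGraph C color).IsClique (Set.range a)) ∧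
    DiffsOrderedBy π fun i => (a i : ℕ)

/-- `R_π(k;q)`: the least positive integer `R` such that every `q`-coloring of the edges of the
complete graph on `[R]` contains a monochromatic `K_k` with differences ordered according to `π`
(it would be `⊤` if there were no such `R`). -/
noncomputable def ramseyPerm (k q : ℕ) (π : Equiv.Perm (Fin (k - 1))) : ℕ∞ :=
  sInf {N : ℕ∞ | ∃ R : ℕ, 0 < R ∧ (∀ C : Coloring R q, HasMonoClique π C) ∧ N = (R : ℕ∞)}

/-- `R(k;q)`: the maximum of `R_π(k;q)` over all permutations `π` of `[k-1]`. -/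
noncomputable def ramsey (k q : ℕ) : ℕ∞ :=
  ⨆ π : Equiv.Perm (Fin (k - 1)), ramseyPerm k q π

end OrderRamsey

/-!
Let `B` be a large power of two and view `{0, …, B ^ D - 1}` as the leaves of a `B`-ary tree of
depth `D`. A cell of height `h` consists of the numbers that agree from the digit of weight `B ^ h`
on. If two numbers lie in one cell of height `t + 1` but in different, non-adjacent cells of height
`t`, then their difference is between `B ^ t` and `B ^ (t + 1)`. It is therefore enough to find a
monochromatic clique in which the heights where consecutive vertices separate are ordered as `π`
prescribes.

Suppose that there is none. The proof shows, for `j = 0, 1, …, q`, that every dense set of leaves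
contains a pair of dense subsets, separated at one height, between which the union of the first
`j` colors is sparse (`HasSparsePairs`). For `j = q` the union is complete, which is absurd.

The step from `j` to `j + 1` (`HasSparsePairs.or`) has two parts.

* Sparse pairs for the first `j` colors combine to `k` dense sets that are pairwise sparse in these
  colors and whose positions in the tree form the prescribed pattern
  (`HasSparsePairs.exists_tuple`). Each gap of the pattern has its own block of heights, and the
  set that has to be divided at this gap is divided within this block. So the number of heights in
  use is multiplied by `k - 1`.
* Every transversal of these `k` sets has the prescribed pattern, so color `j` has no transversal
  clique. A greedy embedding then fails, and this exhibits two of the sets with large subsets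
  between which color `j` is sparse as well (`exists_clique_or_sparse_pair`). Passing to these
  subsets costs the first `j` colors a factor that their sparsity was chosen to absorb.

Each color costs a factor `O(k)` in the exponents of sparsity and of density, and `D = (k - 1) ^ q`,
so `log₂ (B ^ D)` is bounded by a power of `k` with exponent linear in `q`.
-/

namespace OrderRamsey

/-! ### Cells of the base-`B` tree -/

/-- All elements of `U` lie in one cell of height `h`: their base-`B` expansions agree from the
digit of weight `B ^ h` on. -/
def SameCell (B h : ℕ) (U : Finset ℕ) : Prop :=
  ∀ x ∈ U, ∀ y ∈ U, x / B ^ h = y / B ^ h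

/-- `U` lies in a cell of height `h`, and fills at least the fraction `2 ^ (-a)` of it. -/
def IsDense (B h a : ℕ) (U : Finset ℕ) : Prop :=
  SameCell B h U ∧ B ^ h ≤ 2 ^ a * U.card

/-- `x` and `y` lie in one cell of height `t + 1`, and in subcells of height `t` of which the
second lies to the right of the first and is not adjacent to it. -/
def SplitAt (B t x y : ℕ) : Prop :=
  x / B ^ (t + 1) = y / B ^ (t + 1) ∧ x / B ^ t + 2 ≤ y / B ^ t

theorem SameCell.mono {B h : ℕ} {U V : Finset ℕ} (hU : SameCell B h U) (hV : V ⊆ U) :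
    SameCell B h V :=
  fun x hx y hy => hU x (hV hx) y (hV hy)

theorem IsDense.nonempty {B h a : ℕ} (hB : 0 < B) {U : Finset ℕ} (hU : IsDense B h a U) :
    U.Nonempty := by
  rw [← Finset.card_pos]
  have h1 := hU.2
  have h2 : 0 < B ^ h := by positivity
  exact pos_of_mul_pos_right (h2.trans_le h1) (Nat.zero_le _)

theorem IsDense.of_card {B h a c : ℕ} {U V : Finset ℕ} (hU : IsDense B h a U) (hV : V ⊆ U)
    (hc : U.card ≤ 2 ^ c * V.card) : IsDense B h (a + c) V := by
  refine ⟨hU.1.mono hV, hU.2.trans ?_⟩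
  calc 2 ^ a * U.card ≤ 2 ^ a * (2 ^ c * V.card) := by gcongr
    _ = 2 ^ (a + c) * V.card := by ring

theorem IsDense.mono {B h a c : ℕ} {U : Finset ℕ} (hU : IsDense B h a U) (hac : a ≤ c) :
    IsDense B h c U :=
  ⟨hU.1, hU.2.trans (Nat.mul_le_mul_right _ (Nat.pow_le_pow_right (by norm_num) hac))⟩

theorem SplitAt.lt {B t x y : ℕ} (h : SplitAt B t x y) : x < y := by
  by_contra hc
  have := Nat.div_le_div_right (c := B ^ t) (not_lt.mp hc)
  have := h.2
  omega

theorem SplitAt.pow_lt_sub {B t x y : ℕ} (hB : 0 < B) (h : SplitAt B t x y) :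
    B ^ t < y - x := by
  have h1 := Nat.div_mul_le_self y (B ^ t)
  have h2 := Nat.lt_div_mul_add (a := x) (b := B ^ t) (by positivity)
  have h3 : (x / B ^ t + 2) * B ^ t ≤ y / B ^ t * B ^ t := Nat.mul_le_mul_right _ h.2
  have h4 : (x / B ^ t + 2) * B ^ t = x / B ^ t * B ^ t + 2 * B ^ t := by ring
  omega

theorem SplitAt.sub_lt_pow {B t x y : ℕ} (hB : 0 < B) (h : SplitAt B t x y) :
    y - x < B ^ (t + 1) := by
  have h1 := Nat.div_mul_le_self x (B ^ (t + 1))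
  have h2 := Nat.lt_div_mul_add (a := y) (b := B ^ (t + 1)) (by positivity)
  have h3 : 0 < B ^ (t + 1) := by positivity
  rw [h.1] at h1
  omega

theorem SplitAt.sub_lt_sub {B s t x y u v : ℕ} (hB : 0 < B) (h : SplitAt B s x y)
    (h' : SplitAt B t u v) (hst : s < t) : y - x < v - u :=
  (h.sub_lt_pow hB).trans_le
    ((Nat.pow_le_pow_right hB hst).trans (h'.pow_lt_sub hB).le)

/-- A cell of height `h + s` consists of `B ^ s` cells of height `h`. -/
theorem SameCell.card_image_le {B h s : ℕ} (hB : 0 < B) {U : Finset ℕ}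
    (hU : SameCell B (h + s) U) : (U.image (· / B ^ h)).card ≤ B ^ s := by
  rcases U.eq_empty_or_nonempty with rfl | ⟨x, hx⟩
  · simp
  have : U.image (· / B ^ h) ⊆
      Finset.Ico (x / B ^ (h + s) * B ^ s) (x / B ^ (h + s) * B ^ s + B ^ s) := by
    intro z hz
    obtain ⟨y, hy, rfl⟩ := Finset.mem_image.mp hz
    have h1 : y / B ^ h / B ^ s = x / B ^ (h + s) := by
      rw [Nat.div_div_eq_div_mul, ← pow_add]; exact hU y hy x hx
    rw [Finset.mem_Ico, ← h1]
    exact ⟨Nat.div_mul_le_self _ _, Nat.lt_div_mul_add (by positivity)⟩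
  simpa using Finset.card_le_card this

theorem SameCell.card_le {B h : ℕ} (hB : 0 < B) {U : Finset ℕ} (hU : SameCell B h U) :
    U.card ≤ B ^ h := by
  have := SameCell.card_image_le (h := 0) (s := h) hB (by simpa using hU)
  simpa using this

/-- By averaging, a dense set in a cell is as dense in some smaller cell. -/
theorem IsDense.exists_subcell {B h s a : ℕ} (hB : 0 < B) {U : Finset ℕ}
    (hU : IsDense B (h + s) a U) : ∃ V ⊆ U, IsDense B h a V := by
  classical
  by_contra! hcon
  have hne := hU.nonempty hB
  set I := U.image (· / B ^ h) with hI
  have hIne : I.Nonempty := hne.image _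
  have hfib : ∀ z ∈ I, 2 ^ a * (U.filter (· / B ^ h = z)).card < B ^ h := by
    intro z _
    by_contra! hz
    refine hcon _ (Finset.filter_subset _ U) ⟨?_, hz⟩
    intro x hx y hy
    rw [(Finset.mem_filter.mp hx).2, (Finset.mem_filter.mp hy).2]
  have h1 : U.card = ∑ z ∈ I, (U.filter (· / B ^ h = z)).card :=
    Finset.card_eq_sum_card_image _ _
  have h2 : 2 ^ a * U.card < I.card * B ^ h := by
    rw [h1, Finset.mul_sum, ← smul_eq_mul (a := I.card), ← Finset.sum_const]
    exact Finset.sum_lt_sum_of_nonempty hIne hfib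
  have h3 : I.card * B ^ h ≤ B ^ s * B ^ h := Nat.mul_le_mul_right _ (hU.1.card_image_le hB)
  have h4 := hU.2
  rw [pow_add, mul_comm] at h4
  omega

/-- A dense set in a cell of height `h + 1` is at least half as dense in two subcells of
height `h` that are not adjacent, because at least three subcells have this property. -/
theorem IsDense.exists_split {B h a : ℕ} {U : Finset ℕ} (hU : IsDense B (h + 1) a U)
    (ha : 2 ^ (a + 3) ≤ B) :
    ∃ V ⊆ U, ∃ W ⊆ U, IsDense B h (a + 1) V ∧ IsDense B h (a + 1) W ∧
      ∀ x ∈ V, ∀ y ∈ W, SplitAt B h x y := by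
  classical
  have hB : 0 < B := lt_of_lt_of_le (by positivity) ha
  set I := U.image (· / B ^ h) with hI
  set F : ℕ → Finset ℕ := fun z => U.filter (· / B ^ h = z) with hF
  set H := I.filter fun z => B ^ h ≤ 2 ^ (a + 1) * (F z).card with hH
  have hcell : ∀ z, SameCell B h (F z) := by
    intro z x hx y hy
    rw [(Finset.mem_filter.mp hx).2, (Finset.mem_filter.mp hy).2]
  have h1 : U.card = ∑ z ∈ I, (F z).card := Finset.card_eq_sum_card_image _ _
  have h2 : ∀ z ∈ I, 2 ^ (a + 1) * (F z).card ≤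
      B ^ h + if B ^ h ≤ 2 ^ (a + 1) * (F z).card then 2 ^ (a + 1) * B ^ h else 0 := by
    intro z _
    split_ifs with hz
    · exact (Nat.mul_le_mul_left _ ((hcell z).card_le hB)).trans (Nat.le_add_left _ _)
    · omega
  have h3 : 2 ^ (a + 1) * U.card ≤ I.card * B ^ h + H.card * (2 ^ (a + 1) * B ^ h) := by
    rw [h1, Finset.mul_sum]
    refine (Finset.sum_le_sum h2).trans ?_
    rw [Finset.sum_add_distrib, ← Finset.sum_filter]
    simp [hH]
  have h4 : I.card * B ^ h ≤ B * B ^ h := by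
    have := hU.1.card_image_le hB
    rw [pow_one] at this
    exact Nat.mul_le_mul_right _ this
  have h5 : 2 * (B * B ^ h) ≤ 2 ^ (a + 1) * U.card := by
    have := hU.2
    rw [pow_succ] at this
    rw [pow_succ]
    nlinarith
  have h6 : B * B ^ h ≤ H.card * 2 ^ (a + 1) * B ^ h := by
    rw [mul_assoc]; omega
  have h7 : B ≤ H.card * 2 ^ (a + 1) := Nat.le_of_mul_le_mul_right h6 (by positivity)
  have h8 : 3 ≤ H.card := by
    have : 4 * 2 ^ (a + 1) ≤ H.card * 2 ^ (a + 1) := by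
      refine le_trans (le_of_eq ?_) (ha.trans h7)
      ring
    have := Nat.le_of_mul_le_mul_right this (by positivity)
    omega
  have hne : H.Nonempty := by rw [← Finset.card_pos]; omega
  have h9 : H.min' hne + 2 ≤ H.max' hne := by
    have : H ⊆ Finset.Icc (H.min' hne) (H.max' hne) := fun z hz =>
      Finset.mem_Icc.mpr ⟨H.min'_le z hz, H.le_max' z hz⟩
    have := Finset.card_le_card this
    rw [Nat.card_Icc] at this
    omega
  refine ⟨F (H.min' hne), Finset.filter_subset _ _, F (H.max' hne), Finset.filter_subset _ _,
    ⟨hcell _, (Finset.mem_filter.mp (H.min'_mem hne)).2⟩,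
    ⟨hcell _, (Finset.mem_filter.mp (H.max'_mem hne)).2⟩, ?_⟩
  intro x hx y hy
  refine ⟨hU.1 x (Finset.mem_filter.mp hx).1 y (Finset.mem_filter.mp hy).1, ?_⟩
  rw [(Finset.mem_filter.mp hx).2, (Finset.mem_filter.mp hy).2]
  exact h9

/-! ### Degrees -/

open Classical in
/-- The number of `y ∈ U` with `G x y`. -/
noncomputable def deg (G : ℕ → ℕ → Prop) (x : ℕ) (U : Finset ℕ) : ℕ :=
  (U.filter fun y => G x y).card

theorem deg_mono_right {G : ℕ → ℕ → Prop} {x : ℕ} {U V : Finset ℕ} (h : V ⊆ U) :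
    deg G x V ≤ deg G x U := by
  classical
  exact Finset.card_le_card (Finset.filter_subset_filter _ h)

open Classical in
/-- If every `x ∈ S` has few neighbours in `T`, then by double counting and Markov's inequality
few `y ∈ T` have many neighbours in `S`. -/
theorem card_filter_deg_le {G : ℕ → ℕ → Prop} {S T : Finset ℕ} {c e : ℕ} (hS : S.Nonempty)
    (h : ∀ x ∈ S, 2 ^ (e + c) * deg G x T ≤ T.card) :
    2 ^ c * (T.filter fun y => S.card < 2 ^ e * deg (fun y x => G x y) y S).card ≤ T.card := by
  set Bad := T.filter fun y => S.card < 2 ^ e * deg (fun y x => G x y) y S with hBad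
  have h1 : Bad.card * S.card ≤ ∑ y ∈ Bad, 2 ^ e * deg (fun y x => G x y) y S := by
    rw [← smul_eq_mul, ← Finset.sum_const]
    exact Finset.sum_le_sum fun y hy => (Finset.mem_filter.mp hy).2.le
  have h2 : ∑ y ∈ Bad, deg (fun y x => G x y) y S ≤ ∑ y ∈ T, deg (fun y x => G x y) y S :=
    Finset.sum_le_sum_of_subset (Finset.filter_subset _ _)
  have h3 : ∑ y ∈ T, deg (fun y x => G x y) y S = ∑ x ∈ S, deg G x T := by
    have := Finset.sum_card_bipartiteAbove_eq_sum_card_bipartiteBelow (s := S) (t := T) G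
    exact this.symm
  have h4 : 2 ^ (e + c) * ∑ x ∈ S, deg G x T ≤ S.card * T.card := by
    rw [Finset.mul_sum, ← smul_eq_mul (a := S.card), ← Finset.sum_const]
    exact Finset.sum_le_sum h
  refine Nat.le_of_mul_le_mul_right (c := S.card) ?_ hS.card_pos
  rw [← Finset.mul_sum] at h1
  calc 2 ^ c * Bad.card * S.card = 2 ^ c * (Bad.card * S.card) := by ring
    _ ≤ 2 ^ c * (2 ^ e * ∑ x ∈ S, deg G x T) := by
        rw [← h3]; exact Nat.mul_le_mul_left _ (h1.trans (Nat.mul_le_mul_left _ h2))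
    _ = 2 ^ (e + c) * ∑ x ∈ S, deg G x T := by ring
    _ ≤ T.card * S.card := by rw [mul_comm T.card]; exact h4

theorem deg_or_le (G H : ℕ → ℕ → Prop) (x : ℕ) (U : Finset ℕ) :
    deg (fun x y => G x y ∨ H x y) x U ≤ deg G x U + deg H x U := by
  classical
  simp only [deg, Finset.filter_or]
  exact Finset.card_union_le _ _

/-! ### Sparse pairs and sparse tuples -/

/-- Every dense set in a cell of height `h + s` contains two dense subsets, in cells of height
`h` that separate at some height in `[h, h + s)`, such that each vertex of the first is joined in
`G` to at most the fraction `2 ^ (-e)` of the second. The expansions are in base `2 ^ b`, and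
passing to the subsets costs a factor of at most `2 ^ L` in density. The densities are required
to stay at least `4 / 2 ^ b`, so that no cell is exhausted by few of its subcells. -/
def HasSparsePairs (b : ℕ) (G : ℕ → ℕ → Prop) (s L e : ℕ) : Prop :=
  ∀ h a U, IsDense (2 ^ b) (h + s) a U → a + L + 2 ≤ b →
    ∃ t, h ≤ t ∧ t < h + s ∧ ∃ V ⊆ U, ∃ W ⊆ U,
      IsDense (2 ^ b) h (a + L) V ∧ IsDense (2 ^ b) h (a + L) W ∧
      (∀ x ∈ V, ∀ y ∈ W, SplitAt (2 ^ b) t x y) ∧ ∀ x ∈ V, 2 ^ e * deg G x W ≤ W.card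

theorem hasSparsePairs_of_forall_not {G : ℕ → ℕ → Prop} (hG : ∀ x y, ¬ G x y) (b e : ℕ) :
    HasSparsePairs b G 1 1 e := by
  intro h a U hU ha
  obtain ⟨V, hV, W, hW, hV', hW', hVW⟩ :=
    hU.exists_split (Nat.pow_le_pow_right (by norm_num) (by omega))
  refine ⟨h, le_rfl, by omega, V, hV, W, hW, hV', hW', hVW, fun x _ => ?_⟩
  simp [deg, hG]

theorem HasSparsePairs.mono {b : ℕ} {G : ℕ → ℕ → Prop} {s L e L' e' : ℕ}
    (hP : HasSparsePairs b G s L e) (hL : L ≤ L') (he : e' ≤ e) : HasSparsePairs b G s L' e' := by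
  intro h a U hU ha
  obtain ⟨t, h1, h2, V, hV, W, hW, hV', hW', hVW, hd⟩ := hP h a U hU (by omega)
  exact ⟨t, h1, h2, V, hV, W, hW, hV'.mono (by omega), hW'.mono (by omega), hVW, fun x hx =>
    (Nat.mul_le_mul_right _ (Nat.pow_le_pow_right (by norm_num) he)).trans (hd x hx)⟩

/-- Let `ρ` rank the gaps between the positions `l, …, l + n`. Sparse pairs combine into dense
sets at these positions that are pairwise sparse and such that the gap between `i` and `i + 1`
arises at a height in the block `[h + ρ i * s, h + (ρ i + 1) * s)`; as a result the gaps are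
ordered as their ranks.

A sparse pair `U₁, U₂` is placed at the gap of highest rank. The sets left of this gap are then
found inside `U₁`. Before continuing with the sets on the right, `U₂` is reduced to those at least
half of its vertices that are sparse to each of the sets on the left. That condition concerns one
vertex of `U₂` at a time and so survives the passage to subsets of `U₂`, so the sparsity degrades
only once for each pair of positions. -/
theorem HasSparsePairs.exists_tuple {b : ℕ} {G : ℕ → ℕ → Prop} {s L e c k : ℕ}
    (hP : HasSparsePairs b G s L (e + c)) (hk : 2 * k ≤ 2 ^ c) {ρ : ℕ → ℕ} (h : ℕ) (n : ℕ) :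
    n < k → ∀ l m a U, (∀ i, l ≤ i → i < l + n → ρ i < m) →
      Set.InjOn ρ (Set.Ico l (l + n)) → IsDense (2 ^ b) (h + m * s) a U →
      a + n * (L + 1) + 2 ≤ b →
      ∃ W : ℕ → Finset ℕ,
        (∀ i, l ≤ i → i ≤ l + n → W i ⊆ U ∧ IsDense (2 ^ b) h (a + n * (L + 1)) (W i)) ∧
        ∀ i j, l ≤ i → i < j → j ≤ l + n →
          (∃ t, h ≤ t ∧ t < h + m * s ∧
            (j = i + 1 → h + ρ i * s ≤ t ∧ t < h + (ρ i + 1) * s) ∧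
            ∀ x ∈ W i, ∀ y ∈ W j, SplitAt (2 ^ b) t x y) ∧
          ∀ y ∈ W j, 2 ^ e * deg (fun y x => G x y) y (W i) ≤ (W i).card := by
  classical
  have hB : 0 < 2 ^ b := by positivity
  induction n using Nat.strong_induction_on with
  | _ n ih =>
  intro hnk l m a U hρm hρ hU ha
  rcases Nat.eq_zero_or_pos n with rfl | hn
  · obtain ⟨V, hV, hV'⟩ := hU.exists_subcell hB
    refine ⟨fun _ => V, fun i _ _ => ⟨hV, by simpa using hV'⟩, fun i j h1 h2 h3 => ?_⟩
    omega
  obtain ⟨p, hp, hpmax⟩ := Finset.exists_max_image (Finset.Ico l (l + n)) ρ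
    ⟨l, Finset.mem_Ico.mpr ⟨le_rfl, by omega⟩⟩
  obtain ⟨hlp, hpn⟩ := Finset.mem_Ico.mp hp
  have hlt : ∀ i, l ≤ i → i < l + n → i ≠ p → ρ i < ρ p := by
    intro i h1 h2 h3
    refine lt_of_le_of_ne (hpmax i (Finset.mem_Ico.mpr ⟨h1, h2⟩)) fun h4 => h3 ?_
    exact hρ ⟨h1, h2⟩ ⟨hlp, hpn⟩ h4
  have hpm : (ρ p + 1) * s ≤ m * s := Nat.mul_le_mul_right _ (hρm p hlp hpn)
  have hps : (ρ p + 1) * s = ρ p * s + s := by ring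
  -- Descend to the block of the gap `p`.
  obtain ⟨U', hU'U, hU'⟩ := IsDense.exists_subcell (h := h + ρ p * s + s)
    (s := m * s - (ρ p + 1) * s) hB (U := U) (a := a) (by convert hU using 1; omega)
  have hLn : (L + 1) ≤ n * (L + 1) := Nat.le_mul_of_pos_left _ hn
  obtain ⟨t, ht1, ht2, U₁, hU₁, U₂, hU₂, hU₁', hU₂', hsplit, hdeg⟩ :=
    hP _ a U' hU' (by omega)
  have hn1 : (p - l) * (L + 1) + (L + 1) ≤ n * (L + 1) := by
    rw [← Nat.succ_mul]; exact Nat.mul_le_mul_right _ (by omega)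
  have hn2 : (l + n - (p + 1)) * (L + 1) + (L + 1) ≤ n * (L + 1) := by
    rw [← Nat.succ_mul]; exact Nat.mul_le_mul_right _ (by omega)
  obtain ⟨W₁, hW₁, hW₁'⟩ := ih (p - l) (by omega) (by omega) l (ρ p) (a + L) U₁
    (fun i h1 h2 => hlt i h1 (by omega) (by omega))
    (hρ.mono (Set.Ico_subset_Ico le_rfl (by omega))) hU₁' (by omega)
  set Bad : ℕ → Finset ℕ := fun i =>
    U₂.filter fun y => (W₁ i).card < 2 ^ e * deg (fun y x => G x y) y (W₁ i) with hBad
  have hBadcard : ∀ i ∈ Finset.Icc l p, 2 ^ c * (Bad i).card ≤ U₂.card := by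
    intro i hi
    obtain ⟨hi1, hi2⟩ := Finset.mem_Icc.mp hi
    obtain ⟨h1, h2⟩ := hW₁ i hi1 (by omega)
    exact card_filter_deg_le (h2.nonempty hB) fun x hx => hdeg x (h1 hx)
  have hsum : 2 * ∑ i ∈ Finset.Icc l p, (Bad i).card ≤ U₂.card := by
    have h1 : 2 ^ c * ∑ i ∈ Finset.Icc l p, (Bad i).card ≤ k * U₂.card := by
      rw [Finset.mul_sum]
      refine (Finset.sum_le_sum hBadcard).trans ?_
      rw [Finset.sum_const, smul_eq_mul, Nat.card_Icc]
      exact Nat.mul_le_mul_right _ (by omega)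
    refine Nat.le_of_mul_le_mul_left (c := k) ?_ (by omega)
    calc k * (2 * ∑ i ∈ Finset.Icc l p, (Bad i).card)
        = 2 * k * ∑ i ∈ Finset.Icc l p, (Bad i).card := by ring
      _ ≤ 2 ^ c * ∑ i ∈ Finset.Icc l p, (Bad i).card := Nat.mul_le_mul_right _ hk
      _ ≤ k * U₂.card := h1
  set V := U₂ \ (Finset.Icc l p).biUnion Bad with hV
  have hVcard : U₂.card ≤ 2 ^ 1 * V.card := by
    have h1 : _ ≤ V.card := Finset.le_card_sdiff ((Finset.Icc l p).biUnion Bad) U₂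
    have h2 : ((Finset.Icc l p).biUnion Bad).card ≤ _ := Finset.card_biUnion_le
    omega
  have hVU : V ⊆ U₂ := Finset.sdiff_subset
  have hVdeg : ∀ i, l ≤ i → i ≤ p → ∀ y ∈ V,
      2 ^ e * deg (fun y x => G x y) y (W₁ i) ≤ (W₁ i).card := by
    intro i h1 h2 y hy
    by_contra! hc
    exact (Finset.mem_sdiff.mp hy).2 (Finset.mem_biUnion.mpr ⟨i, Finset.mem_Icc.mpr ⟨h1, h2⟩,
      Finset.mem_filter.mpr ⟨hVU hy, hc⟩⟩)
  obtain ⟨W₂, hW₂, hW₂'⟩ := ih (l + n - (p + 1)) (by omega) (by omega) (p + 1) (ρ p)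
    (a + L + 1) V (fun i h1 h2 => hlt i (by omega) (by omega) (by omega))
    (hρ.mono (Set.Ico_subset_Ico (by omega) (by omega))) (hU₂'.of_card hVU hVcard) (by omega)
  refine ⟨fun i => if i ≤ p then W₁ i else W₂ i, fun i h1 h2 => ?_, fun i j h1 h2 h3 => ?_⟩
  · by_cases hip : i ≤ p
    · obtain ⟨h4, h5⟩ := hW₁ i h1 (by omega)
      simp only [hip, if_true]
      exact ⟨h4.trans (hU₁.trans hU'U), h5.mono (by omega)⟩
    · obtain ⟨h4, h5⟩ := hW₂ i (by omega) (by omega)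
      simp only [hip, if_false]
      exact ⟨h4.trans (hVU.trans (hU₂.trans hU'U)), h5.mono (by omega)⟩
  · by_cases hjp : j ≤ p
    · have hip : i ≤ p := by omega
      simp only [hip, hjp, if_true]
      obtain ⟨⟨u, hu1, hu2, hu3⟩, h5⟩ := hW₁' i j h1 h2 (by omega)
      exact ⟨⟨u, hu1, by omega, hu3⟩, h5⟩
    by_cases hip : i ≤ p
    · simp only [hip, hjp, if_true, if_false]
      obtain ⟨h4, -⟩ := hW₁ i h1 (by omega)
      obtain ⟨h5, -⟩ := hW₂ j (by omega) (by omega)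
      refine ⟨⟨t, by omega, by omega, ?_, fun x hx y hy => hsplit x (h4 hx) y (hVU (h5 hy))⟩,
        fun y hy => hVdeg i h1 hip y (h5 hy)⟩
      intro hij
      obtain rfl : i = p := by omega
      omega
    · simp only [hip, hjp, if_false]
      obtain ⟨⟨u, hu1, hu2, hu3⟩, h5⟩ := hW₂' i j (by omega) h2 (by omega)
      exact ⟨⟨u, hu1, by omega, hu3⟩, h5⟩

/-! ### Greedy embedding of cliques -/

/-- Greedy embedding: either one vertex of each of the nonempty sets `W l, …, W (l + n)` can be
chosen so that any two are joined in `G`, or two of these sets have large subsets between which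
`G` is sparse. In the second case some chosen vertex could not be given enough neighbours in all
later sets, whichever way it was chosen. -/
theorem exists_clique_or_sparse_pair (G : ℕ → ℕ → Prop) (e k n : ℕ) :
    n < k → ∀ (l : ℕ) (W : ℕ → Finset ℕ), (∀ i, l ≤ i → i ≤ l + n → (W i).Nonempty) →
      (∃ x : ℕ → ℕ, (∀ i, l ≤ i → i ≤ l + n → x i ∈ W i) ∧
        ∀ i j, l ≤ i → i < j → j ≤ l + n → G (x i) (x j)) ∨
      ∃ i j, l ≤ i ∧ i < j ∧ j ≤ l + n ∧ ∃ V ⊆ W i, ∃ V' ⊆ W j,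
        (W i).card ≤ 2 ^ (n * e + k) * V.card ∧ (W j).card ≤ 2 ^ (n * e + k) * V'.card ∧
        ∀ x ∈ V, 2 ^ e * deg G x V' ≤ V'.card := by
  classical
  induction n with
  | zero =>
    intro _ l W hW
    obtain ⟨x, hx⟩ := hW l le_rfl le_rfl
    refine Or.inl ⟨fun _ => x, fun i h1 h2 => ?_, fun i j h1 h2 h3 => by omega⟩
    obtain rfl : i = l := by omega
    exact hx
  | succ n ih =>
    intro hnk l W hW
    by_cases hgood : ∃ v ∈ W l, ∀ i, l < i → i ≤ l + (n + 1) → (W i).card < 2 ^ e * deg G v (W i)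
    · obtain ⟨v, hv, hvdeg⟩ := hgood
      set N : ℕ → Finset ℕ := fun i => (W i).filter fun y => G v y with hN
      have hNcard : ∀ i, l < i → i ≤ l + (n + 1) → (W i).card < 2 ^ e * (N i).card := by
        intro i h1 h2
        have := hvdeg i h1 h2
        simp only [deg] at this
        convert this
      have hNne : ∀ i, l + 1 ≤ i → i ≤ l + 1 + n → (N i).Nonempty := by
        intro i h1 h2
        have := hNcard i (by omega) (by omega)
        rw [← Finset.card_pos]
        exact pos_of_mul_pos_right (Nat.zero_lt_of_lt this) (Nat.zero_le _)
      rcases ih (by omega) (l + 1) N hNne with ⟨x, hx, hxG⟩ | hpair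
      · refine Or.inl ⟨fun i => if i = l then v else x i, fun i h1 h2 => ?_,
          fun i j h1 h2 h3 => ?_⟩
        · by_cases hil : i = l
          · simpa [hil] using hv
          · simpa [hil] using (Finset.mem_filter.mp (hx i (by omega) (by omega))).1
        · have hjl : j ≠ l := by omega
          by_cases hil : i = l
          · simpa [hil, hjl] using (Finset.mem_filter.mp (hx j (by omega) (by omega))).2
          · simpa [hil, hjl] using hxG i j (by omega) h2 (by omega)
      · obtain ⟨i, j, h1, h2, h3, V, hV, V', hV', hc, hc', hd⟩ := hpair
        have key : ∀ i X, l < i → i ≤ l + (n + 1) → (N i).card ≤ 2 ^ (n * e + k) * X →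
            (W i).card ≤ 2 ^ ((n + 1) * e + k) * X := by
          intro i X h1 h2 h3
          calc (W i).card ≤ 2 ^ e * (N i).card := (hNcard i h1 h2).le
            _ ≤ 2 ^ e * (2 ^ (n * e + k) * X) := Nat.mul_le_mul_left _ h3
            _ = 2 ^ ((n + 1) * e + k) * X := by ring
        exact Or.inr ⟨i, j, by omega, h2, by omega, V, hV.trans (Finset.filter_subset _ _), V',
          hV'.trans (Finset.filter_subset _ _), key i _ (by omega) (by omega) hc,
          key j _ (by omega) (by omega) hc', hd⟩
    · push Not at hgood
      -- Every `v ∈ W l` has few neighbours in some later set: take the most popular one.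
      choose! f hf1 hf2 hf3 using hgood
      have hmaps : ∀ v ∈ W l, f v ∈ Finset.Ioc l (l + (n + 1)) := fun v hv =>
        Finset.mem_Ioc.mpr ⟨hf1 v hv, hf2 v hv⟩
      obtain ⟨j, hj, hjc⟩ : ∃ j ∈ Finset.Ioc l (l + (n + 1)),
          (W l).card ≤ (n + 1) * ((W l).filter fun v => f v = j).card := by
        by_contra! hc
        have h1 := Finset.card_eq_sum_card_fiberwise hmaps
        have h2 : (n + 1) * (W l).card < (n + 1) * (W l).card := by
          conv_lhs => rw [h1, Finset.mul_sum]
          refine (Finset.sum_lt_sum_of_nonempty ⟨l + 1, by simp⟩ hc).trans_le ?_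
          simp
        exact lt_irrefl _ h2
      obtain ⟨hj1, hj2⟩ := Finset.mem_Ioc.mp hj
      have hpow : n + 1 ≤ 2 ^ ((n + 1) * e + k) :=
        (hnk.le.trans Nat.lt_two_pow_self.le).trans (Nat.pow_le_pow_right (by norm_num) (by omega))
      refine Or.inr ⟨l, j, le_rfl, hj1, hj2, _, Finset.filter_subset _ _, W j, subset_rfl,
        hjc.trans (Nat.mul_le_mul_right _ hpow), Nat.le_mul_of_pos_left _ (by positivity), ?_⟩
      intro x hx
      obtain ⟨hx1, hx2⟩ := Finset.mem_filter.mp hx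
      have := hf3 x hx1
      rwa [hx2] at this

/-! ### Adding one color after the other -/

/-- The graph `G` contains a clique `x 0 < ⋯ < x (k - 1)` whose gaps `x (i + 1) - x i` are ordered
in the same way as their ranks `ρ i`. -/
def HasRankedClique (k : ℕ) (ρ : ℕ → ℕ) (G : ℕ → ℕ → Prop) : Prop :=
  ∃ x : ℕ → ℕ, (∀ i j, i < j → j < k → G (x i) (x j)) ∧ (∀ i, i + 1 < k → x i < x (i + 1)) ∧
    ∀ i j, i + 1 < k → j + 1 < k → ρ i < ρ j → x (i + 1) - x i < x (j + 1) - x j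

/-- If `H` has no ranked clique, then sparse pairs for `G` yield sparse pairs for `G ∪ H`: the
greedy embedding fails in a tuple that is sparse for `G`, which gives a pair that is sparse for
`H`, and which remains sparse for `G` because the tuple was chosen sufficiently sparse. -/
theorem HasSparsePairs.or {b : ℕ} {G H : ℕ → ℕ → Prop} {s L e k : ℕ} {ρ : ℕ → ℕ} (hk : 0 < k)
    (hP : HasSparsePairs b G s L (k * (e + 1) + k + 1 + k))
    (hρ : ∀ i, i < k - 1 → ρ i < k - 1) (hinj : Set.InjOn ρ (Set.Ico 0 (k - 1)))
    (hH : ¬ HasRankedClique k ρ H) :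
    HasSparsePairs b (fun x y => G x y ∨ H x y) ((k - 1) * s)
      ((k - 1) * (L + 1) + ((k - 1) * (e + 1) + k) + 1) e := by
  classical
  have hB : 0 < 2 ^ b := by positivity
  have h2k : 2 * k ≤ 2 ^ k := by
    obtain ⟨n, rfl⟩ : ∃ n, k = n + 1 := ⟨k - 1, by omega⟩
    have : n < 2 ^ n := Nat.lt_two_pow_self
    rw [pow_succ]
    omega
  intro h a U hU ha
  obtain ⟨W, hW, hWW⟩ := hP.exists_tuple h2k (ρ := ρ) h (k - 1) (by omega) 0 (k - 1) a U
    (fun i _ hi => hρ i (by omega)) (by simpa using hinj) hU (by omega)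
  have hWne : ∀ i, 0 ≤ i → i ≤ 0 + (k - 1) → (W i).Nonempty := fun i h1 h2 =>
    (hW i h1 h2).2.nonempty hB
  rcases exists_clique_or_sparse_pair H (e + 1) k (k - 1) (by omega) 0 W hWne with
    ⟨x, hx, hxH⟩ | ⟨i, j, -, hij, hj, V, hV, V', hV', hc, hc', hd⟩
  · refine absurd ⟨x, fun i j h1 h2 => hxH i j (by omega) h1 (by omega), ?_, ?_⟩ hH
    · intro i hi
      obtain ⟨⟨t, -, -, -, ht⟩, -⟩ := hWW i (i + 1) (by omega) (by omega) (by omega)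
      exact (ht _ (hx i (by omega) (by omega)) _ (hx (i + 1) (by omega) (by omega))).lt
    · intro i j hi hj hij
      obtain ⟨⟨t, -, -, hti, ht⟩, -⟩ := hWW i (i + 1) (by omega) (by omega) (by omega)
      obtain ⟨⟨u, -, -, huj, hu⟩, -⟩ := hWW j (j + 1) (by omega) (by omega) (by omega)
      refine SplitAt.sub_lt_sub hB
        (ht _ (hx i (by omega) (by omega)) _ (hx (i + 1) (by omega) (by omega)))
        (hu _ (hx j (by omega) (by omega)) _ (hx (j + 1) (by omega) (by omega))) ?_
      have h1 : (ρ i + 1) * s ≤ ρ j * s := Nat.mul_le_mul_right _ hij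
      have h2 := hti rfl
      have h3 := huj rfl
      omega
  · obtain ⟨⟨t, ht1, ht2, -, ht⟩, hdeg⟩ := hWW i j (by omega) hij hj
    obtain ⟨hi1, hi2⟩ := hW i (by omega) (by omega)
    obtain ⟨hj1, hj2⟩ := hW j (by omega) (by omega)
    set β := (k - 1) * (e + 1) + k with hβ
    have hβe : k * (e + 1) + k + 1 = β + (e + 1 + 1) := by
      obtain ⟨n, rfl⟩ : ∃ n, k = n + 1 := ⟨k - 1, by omega⟩
      rw [hβ, Nat.add_sub_cancel]
      ring
    have hVd := hi2.of_card hV hc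
    have hVd' := hj2.of_card hV' hc'
    have hswap : ∀ y ∈ V', 2 ^ (e + 1 + 1) * deg (fun y x => G x y) y V ≤ V.card := by
      intro y hy
      refine Nat.le_of_mul_le_mul_left (c := 2 ^ β) ?_ (by positivity)
      calc 2 ^ β * (2 ^ (e + 1 + 1) * deg (fun y x => G x y) y V)
          = 2 ^ (k * (e + 1) + k + 1) * deg (fun y x => G x y) y V := by rw [hβe]; ring
        _ ≤ 2 ^ (k * (e + 1) + k + 1) * deg (fun y x => G x y) y (W i) :=
            Nat.mul_le_mul_left _ (deg_mono_right hV)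
        _ ≤ (W i).card := hdeg y (hV' hy)
        _ ≤ 2 ^ β * V.card := hc
    have hbad := card_filter_deg_le (hVd'.nonempty hB) hswap
    set A := V.filter fun x => ¬ V'.card < 2 ^ (e + 1) * deg G x V' with hA
    have hAcard : V.card ≤ 2 ^ 1 * A.card := by
      have : (V.filter fun x => V'.card < 2 ^ (e + 1) * deg G x V').card + A.card = V.card := by
        rw [hA]
        convert Finset.card_filter_add_card_filter_not (s := V)
          (fun x => V'.card < 2 ^ (e + 1) * deg G x V')
      change 2 ^ 1 * (V.filter fun x => V'.card < 2 ^ (e + 1) * deg G x V').card ≤ _ at hbad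
      convert_to 2 ^ 1 * (V.filter fun x => V'.card < 2 ^ (e + 1) * deg G x V').card ≤ _ at hbad
      omega
    have hAV : A ⊆ V := Finset.filter_subset _ _
    refine ⟨t, ht1, ht2, A, hAV.trans (hV.trans hi1), V', hV'.trans hj1,
      (hVd.of_card hAV hAcard).mono (by omega), hVd'.mono (by omega),
      fun x hx y hy => ht x (hV (hAV hx)) y (hV' hy), fun x hx => ?_⟩
    have h1 := not_lt.mp (Finset.mem_filter.mp hx).2
    have h2 := hd x (hAV hx)
    have h3 := Nat.mul_le_mul_left (2 ^ e) (deg_or_le G H x V')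
    rw [pow_succ] at h1 h2
    nlinarith

/-- If none of the graphs `H 0, …, H (q - 1)` has a ranked clique, then the union of the first
`j` of them has sparse pairs. The exponent `(5 * k) ^ (q - j)` of the sparsity leaves room for
the losses of the `q - j` remaining steps. -/
theorem hasSparsePairs_iUnion {k q : ℕ} {ρ : ℕ → ℕ} {H : ℕ → ℕ → ℕ → Prop} (hk : 0 < k)
    (hρ : ∀ i, i < k - 1 → ρ i < k - 1) (hinj : Set.InjOn ρ (Set.Ico 0 (k - 1)))
    (hH : ∀ c, c < q → ¬ HasRankedClique k ρ (H c)) (b j : ℕ) (hj : j ≤ q) :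
    HasSparsePairs b (fun x y => ∃ c, c < j ∧ H c x y) ((k - 1) ^ j)
      ((2 * k) ^ j * (5 * (5 * k) ^ q)) ((5 * k) ^ (q - j)) := by
  have hX : 0 < (5 * k) ^ q := by positivity
  induction j with
  | zero =>
    have := hasSparsePairs_of_forall_not (G := fun x y => ∃ c, c < 0 ∧ H c x y)
      (fun x y => by simp) b ((5 * k) ^ q)
    exact this.mono (by simp; omega) (by simp)
  | succ j ih =>
    set E := (5 * k) ^ (q - (j + 1)) with hE
    have hE0 : 0 < E := by positivity
    have hEE : (5 * k) ^ (q - j) = 5 * k * E := by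
      rw [hE, ← pow_succ']
      congr 1
      omega
    have hEX : E ≤ (5 * k) ^ q := Nat.pow_le_pow_right (by omega) (by omega)
    set Y := (2 * k) ^ j with hY
    have hY0 : 0 < Y := by positivity
    have hkE : k ≤ k * E := Nat.le_mul_of_pos_right _ hE0
    have h1 := ih (by omega)
    rw [hEE] at h1
    have h2 := (h1.mono (e' := k * (E + 1) + k + 1 + k) le_rfl (by
      rw [show 5 * k * E = 5 * (k * E) by ring, show k * (E + 1) = k * E + k by ring]
      omega)).or hk hρ hinj (hH j (by omega))
    have h3 := h2.mono (L' := (2 * k) ^ (j + 1) * (5 * (5 * k) ^ q)) (e' := E) (by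
      rw [pow_succ, ← hY]
      set X := (5 * k) ^ q
      have h4 : (k - 1) * (Y * (5 * X) + 1) ≤ k * (Y * (5 * X)) + k := by
        rw [← Nat.mul_succ]
        exact Nat.mul_le_mul_right _ (by omega)
      have h5 : (k - 1) * (E + 1) ≤ k * X + k := by
        rw [← Nat.mul_succ]
        exact Nat.mul_le_mul (by omega) (by omega)
      have h6 : k ≤ k * X := Nat.le_mul_of_pos_right _ hX
      have h7 : k * X ≤ k * X * Y := Nat.le_mul_of_pos_right _ hY0
      have h8 : Y * (2 * k) * (5 * X) = k * (Y * (5 * X)) + 5 * (k * X * Y) := by ring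
      omega) le_rfl
    rw [pow_succ']
    convert h3 using 4 with x y
    constructor
    · rintro ⟨c, hc, h⟩
      rcases Nat.lt_succ_iff_lt_or_eq.mp hc with hc | rfl
      · exact Or.inl ⟨c, hc, h⟩
      · exact Or.inr h
    · rintro (⟨c, hc, h⟩ | h)
      · exact ⟨c, by omega, h⟩
      · exact ⟨j, by omega, h⟩

/-- The number `D * b` of binary digits of the leaves stays within the bound: `D = (k - 1) ^ q` is
the depth of the tree, and `b` exceeds the total loss in density by `2`. -/
theorem exponent_le {k q : ℕ} (hk : 2 ≤ k) (hq : 0 < q) :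
    ((2 * k) ^ q * (5 * (5 * k) ^ q) + 2) * (k - 1) ^ q ≤ k ^ (20 * q) := by
  have h1 : (2 * k) ^ q * (5 * (5 * k) ^ q) = 5 * (10 * k ^ 2) ^ q := by
    rw [mul_left_comm, ← mul_pow]
    ring_nf
  have h2 : 10 * k ^ 2 ≤ k ^ 6 := by
    have : 2 ^ 4 ≤ k ^ 4 := Nat.pow_le_pow_left hk 4
    nlinarith [Nat.zero_le (k ^ 2)]
  have h3 : (10 * k ^ 2) ^ q ≤ k ^ (6 * q) := by
    rw [pow_mul]; exact Nat.pow_le_pow_left h2 q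
  have h4 : 2 ^ 3 ≤ k ^ 3 := Nat.pow_le_pow_left hk 3
  have h5 : 0 < k ^ (6 * q) := by positivity
  calc ((2 * k) ^ q * (5 * (5 * k) ^ q) + 2) * (k - 1) ^ q
      ≤ (k ^ 3 * k ^ (6 * q)) * k ^ q := by
        rw [h1]
        refine Nat.mul_le_mul ?_ (Nat.pow_le_pow_left (by omega) q)
        nlinarith
    _ = k ^ (3 + 6 * q + q) := by rw [pow_add, pow_add]
    _ ≤ k ^ (20 * q) := Nat.pow_le_pow_right (by omega) (by omega)

/-- Once all `q` graphs are included, a sparse pair contains two vertices joined in none of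
them. -/
theorem exists_not_adj {k q : ℕ} {ρ : ℕ → ℕ} {H : ℕ → ℕ → ℕ → Prop} (hk : 2 ≤ k) (hq : 0 < q)
    (hρ : ∀ i, i < k - 1 → ρ i < k - 1) (hinj : Set.InjOn ρ (Set.Ico 0 (k - 1)))
    (hH : ∀ c, c < q → ¬ HasRankedClique k ρ (H c)) :
    ∃ x y, x < y ∧ y < 2 ^ k ^ (20 * q) ∧ ∀ c, c < q → ¬ H c x y := by
  classical
  set L := (2 * k) ^ q * (5 * (5 * k) ^ q) with hL
  have hB : 0 < 2 ^ (L + 2) := by positivity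
  obtain ⟨t, -, -, V, hV, W, hW, hV', hW', hVW, hd⟩ :=
    hasSparsePairs_iUnion (by omega) hρ hinj hH (L + 2) q le_rfl 0 0
      (Finset.range ((2 ^ (L + 2)) ^ (k - 1) ^ q)) ⟨fun x hx y hy => by
        rw [zero_add, Nat.div_eq_of_lt (Finset.mem_range.mp hx),
          Nat.div_eq_of_lt (Finset.mem_range.mp hy)], by simp⟩ (by omega)
  obtain ⟨x, hx⟩ := hV'.nonempty hB
  have hWc := (hW'.nonempty hB).card_pos
  have hdx := hd x hx
  rw [Nat.sub_self, pow_zero, pow_one] at hdx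
  obtain ⟨y, hy, hxy⟩ : ∃ y ∈ W, ¬ ∃ c, c < q ∧ H c x y := by
    by_contra! hc
    have : deg (fun x y => ∃ c, c < q ∧ H c x y) x W = W.card := by
      rw [deg]
      convert congrArg Finset.card (Finset.filter_true_of_mem hc)
    omega
  refine ⟨x, y, (hVW x hx y hy).lt, ?_, fun c hc h => hxy ⟨c, hc, h⟩⟩
  refine (Finset.mem_range.mp (hW hy)).trans_le ?_
  rw [← pow_mul]
  exact Nat.pow_le_pow_right (by norm_num) (exponent_le hk hq)

/-! ### Colorings of `[R]` -/

/-- For `k ≤ 1` nothing has to be shown beyond the existence of a vertex and a color. -/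
theorem hasMonoClique_of_le_one {k q R : ℕ} (hk : k ≤ 1) (hq : 0 < q) (hR : 0 < R)
    (π : Equiv.Perm (Fin (k - 1))) (C : Coloring R q) : HasMonoClique π C := by
  have : Subsingleton (Fin k) := Fin.subsingleton_iff_le_one.mpr hk
  have : IsEmpty (Fin (k - 1)) := by
    rw [Nat.sub_eq_zero_of_le hk]
    infer_instance
  refine ⟨fun _ => ⟨1, by simp; omega⟩, Subsingleton.strictMono _, ⟨⟨0, hq⟩, ?_⟩,
    fun i => isEmptyElim i⟩
  rintro _ ⟨i, rfl⟩ _ ⟨j, rfl⟩ hne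
  exact absurd rfl hne

theorem hasMonoClique {k q R : ℕ} (hq : 0 < q) (hR : 2 ^ k ^ (20 * q) ≤ R)
    (π : Equiv.Perm (Fin (k - 1))) (C : Coloring R q) : HasMonoClique π C := by
  rcases Nat.lt_or_ge k 2 with hk2 | hk2
  · exact hasMonoClique_of_le_one (by omega) hq (lt_of_lt_of_le (by positivity) hR) π C
  have hmem : ∀ {x : ℕ}, x < R → x + 1 ∈ Set.Icc 1 R := fun hx => ⟨by omega, by omega⟩
  -- The color class `c`, with the vertices shifted to `{0, …, R - 1}`.
  let H : ℕ → ℕ → ℕ → Prop := fun c x y => ∃ (hc : c < q) (hx : x < R) (hy : y < R),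
    (SimpleGraph.EdgeLabeling.labelGraph C ⟨c, hc⟩).Adj ⟨x + 1, hmem hx⟩ ⟨y + 1, hmem hy⟩
  -- The gap at `π 0` has to be the largest, and so gets the highest rank `k - 2`.
  let ρ : ℕ → ℕ := fun i => if hi : i < k - 1 then k - 2 - (π.symm ⟨i, hi⟩).val else 0
  have hρ : ∀ i, i < k - 1 → ρ i < k - 1 := by
    intro i hi
    simp only [ρ, hi, dif_pos]
    omega
  have hinj : Set.InjOn ρ (Set.Ico 0 (k - 1)) := by
    rintro i ⟨-, hi⟩ j ⟨-, hj⟩ hij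
    simp only [ρ, hi, hj, dif_pos] at hij
    have h1 := (π.symm ⟨i, hi⟩).isLt
    have h2 := (π.symm ⟨j, hj⟩).isLt
    have h3 : π.symm ⟨i, hi⟩ = π.symm ⟨j, hj⟩ := Fin.ext (by omega)
    simpa using π.symm.injective h3
  by_contra hcon
  obtain ⟨x, y, hxy, hy, hH⟩ := exists_not_adj (H := H) hk2 hq hρ hinj (by
    rintro c hc ⟨x, hxH, hxlt, hgap⟩
    have hxR : ∀ i, i < k → x i < R := by
      intro i hi
      rcases Nat.eq_zero_or_pos i with rfl | h0
      · obtain ⟨-, h, -⟩ := hxH 0 1 (by omega) (by omega)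
        exact h
      · obtain ⟨-, -, h, -⟩ := hxH 0 i h0 hi
        exact h
    refine hcon ⟨fun i => ⟨x i + 1, hmem (hxR i i.isLt)⟩, ?_, ⟨⟨c, hc⟩, ?_⟩, ?_⟩
    · have hmono : ∀ j, j < k → ∀ i, i < j → x i < x j := by
        intro j
        induction j with
        | zero => intro _ i hi; omega
        | succ j ih =>
          intro hj i hi
          have h1 := hxlt j hj
          rcases Nat.lt_succ_iff_lt_or_eq.mp hi with h2 | rfl
          · exact (ih (by omega) i h2).trans h1
          · exact h1
      intro i j hij
      have := hmono j j.isLt i hij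
      rw [Subtype.mk_lt_mk]
      omega
    · rintro _ ⟨i, rfl⟩ _ ⟨j, rfl⟩ hne
      rcases lt_trichotomy i j with hij | rfl | hij
      · obtain ⟨_, _, _, h⟩ := hxH i j hij j.isLt
        exact h
      · exact absurd rfl hne
      · obtain ⟨_, _, _, h⟩ := hxH j i hij i.isLt
        exact h.symm
    · intro r r' hrr
      have h1 := (π r).isLt
      have h2 := (π r').isLt
      have h3 := r'.isLt
      have h4 : r.val < r'.val := hrr
      have hlt := hgap (π r').val (π r).val (by omega) (by omega) (by
        simp only [ρ, h1, h2, dif_pos, Fin.eta, Equiv.symm_apply_apply]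
        omega)
      have h5 := hxlt (π r).val (by omega)
      have h6 := hxlt (π r').val (by omega)
      simp only [consecDiff]
      push_cast
      omega)
  replace hy := hy.trans_le hR
  have hne : (⟨x + 1, hmem (hxy.trans hy)⟩ : Set.Icc 1 R) ≠ ⟨y + 1, hmem hy⟩ := by
    intro h
    have := congrArg Subtype.val h
    simp only at this
    omega
  refine hH (SimpleGraph.EdgeLabeling.get C _ _ hne).val (Fin.isLt _)
    ⟨Fin.isLt _, hxy.trans hy, hy, ?_⟩
  rw [SimpleGraph.TopEdgeLabeling.labelGraph_adj]
  exact ⟨hne, rfl⟩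

end OrderRamsey

theorem theorem2 (k q : ℕ) (hk : 0 < k) (hq : 0 < q) :
    (∀ (π : Equiv.Perm (Fin (k - 1))) (C : OrderRamsey.Coloring (2 ^ k ^ (20 * q)) q),
      OrderRamsey.HasMonoClique π C) ∧
    OrderRamsey.ramsey k q ≤ ((2 ^ k ^ (20 * q) : ℕ) : ℕ∞) :=
  ⟨OrderRamsey.hasMonoClique hq le_rfl, iSup_le fun π =>
    sInf_le ⟨2 ^ k ^ (20 * q), by positivity, OrderRamsey.hasMonoClique hq le_rfl π, rfl⟩⟩
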